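/- Let $r \ge 2$ be an integer. A digraph is a set of vertices together with a set of ordered pairs of vertices, called arcs; an *oriented graph* is a digraph with no loops and no two opposite arcs $uv, vu$, and it is *$r$-regular* if every vertex has exactly $r$ out-arcs and exactly $r$ in-arcs. For a finite digraph $D$, let $\vec\alpha(D)$ be the maximum size of a set of vertices of $D$ which induces a subdigraph with no directed cycle. Then there exist a constant $c > 0$ and an integer $n_0$, both depending only on $r$, such that for every integer $n \ge n_0$ there is at least one $r$-regular oriented graph with vertex set $\{1,\dots,n\}$ and, if $D$ is chosen uniformly at random among all of them, then $$\mathbb P\left(\vec\alpha(D) \le \tfrac{99}{100}\, n\right) \ge 1 - e^{-cn}.$$ -/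

import Mathlib

open MeasureTheory ProbabilityTheory Filter

namespace Digraph

/-- The subdigraph of `D` induced by a set `S` of vertices. -/
def inducedOn {V : Type*} (D : Digraph V) (S : Set V) : Digraph S where
  Adj u v := D.Adj u v

/-- `D` contains a directed cycle: pairwise distinct vertices `c 0, …, c k` (`k + 1 ≥ 1` of them)
with an arc from each to the next, and from the last back to the first (addition in
`Fin (k + 1)` is cyclic). Loops (`k = 0`) and digons (`k = 1`) are directed cycles. -/
def HasDirectedCycle {V : Type*} (D : Digraph V) : Prop :=
  ∃ (k : ℕ) (c : Fin (k + 1) → V), Function.Injective c ∧ ∀ i, D.Adj (c i) (c (i + 1))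

/-- A set of vertices is acyclic if the subdigraph it induces has no directed cycle. -/
def IsAcyclicSet {V : Type*} (D : Digraph V) (S : Set V) : Prop :=
  ¬ (D.inducedOn S).HasDirectedCycle

open Classical in
/-- The maximum size of an acyclic set of vertices of a finite digraph. -/
noncomputable def acyclicNumber {V : Type*} [Fintype V] (D : Digraph V) : ℕ :=
  (Finset.univ.filter fun S : Finset V => D.IsAcyclicSet (S : Set V)).sup Finset.card

/-- An oriented graph: a digraph with no loops and no digons. (Parallel arcs are
excluded by the type `Digraph`.) -/
def IsOrientedGraph {V : Type*} (D : Digraph V) : Prop :=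
  (∀ v, ¬ D.Adj v v) ∧ ∀ u v, D.Adj u v → ¬ D.Adj v u

/-- Every vertex has exactly `r` out-arcs and exactly `r` in-arcs. (For a digraph without
parallel arcs, on a finite vertex set.) -/
def IsRegularDigraph {V : Type*} (D : Digraph V) (r : ℕ) : Prop :=
  ∀ v, {w | D.Adj v w}.ncard = r ∧ {w | D.Adj w v}.ncard = r

/-- Every set of digraphs is an event. -/
instance instMeasurableSpaceDigraph {V : Type*} : MeasurableSpace (Digraph V) := ⊤

instance instDiscreteMeasurableSpaceDigraph {V : Type*} :
    DiscreteMeasurableSpace (Digraph V) := ⟨fun _ => trivial⟩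

/-- The `r`-regular oriented graphs with vertices labelled by `Fin n`. -/
def regularOrientedGraphs (n r : ℕ) : Set (Digraph (Fin n)) :=
  {D | D.IsOrientedGraph ∧ D.IsRegularDigraph r}

end Digraph

/-- The events `A n`, each in its own space with law `P n`, hold with very high probability:
`P n (A n) = 1 - exp (-Ω(n))` as `n → ∞`. (The `P n` are meant to be probability measures
for all large `n`; if `P n` is the zero measure, the inequality below fails at `n ≥ 1`.) -/
def HoldsWithVeryHighProbability {Ω : ℕ → Type*} [∀ n, MeasurableSpace (Ω n)]
    (P : ∀ n, Measure (Ω n)) (A : ∀ n, Set (Ω n)) : Prop :=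
  ∃ c : ℝ, 0 < c ∧ ∀ᶠ n : ℕ in atTop, 1 - Real.exp (-(c * n)) ≤ (P n).real (A n)

/-! Work in the configuration model: give each vertex `r` out-stubs and `r` in-stubs and join them
by a uniform permutation of the `N = n * r` stubs. Each `r`-regular oriented graph comes from
exactly `(r !) ^ (2 * n)` permutations, so ratios of counts of graphs are ratios of counts of
permutations.

An acyclic set of `n - t` vertices has, in a topological order, an initial segment `B` of `b`
vertices. Every arc into `B` starts in `B` or in the `t` vertices outside the set, so all `b * r`
in-stubs of `B` are matched into at most `(t + b) * r` out-stubs. A union bound gives probability at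
most `C(n,t) C(n,b) ((t + b) / n) ^ (b * r)`. With `t = n / 100` and `b = n / 7` this is
exponentially small already for `r = 2`.

It remains to condition on the configuration giving an oriented graph. Since the bad event is
exponentially rare, a polynomial lower bound on the probability of the condition suffices. The mean
number of bad stubs is bounded, so by Markov half of the permutations have at most `10 * r ^ 2` of
them, and that many switchings remove them all. Each switching is undone by one of `N ^ 2`
transpositions, so the loss is at most `N ^ (20 * r ^ 2)`. -/

/-! ### Permutations with constraints on their values. -/

section PermCounting

variable {α : Type*} [Fintype α] [DecidableEq α]

/-- At most `(N - |X|)!` permutations of an `N`-element type have prescribed values on `X`. -/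
theorem Equiv.Perm.card_filter_eqOn_le (X : Finset α) (e : α → α) :
    (Finset.univ.filter fun π : Equiv.Perm α => ∀ x ∈ X, π x = e x).card
      ≤ (Fintype.card α - X.card).factorial := by
  classical
  by_cases h : ∃ π₀ : Equiv.Perm α, ∀ x ∈ X, π₀ x = e x
  · obtain ⟨π₀, h₀⟩ := h
    have hcard : Fintype.card {f : Equiv.Perm α // ∀ a, ¬ (a ∉ X) → f a = a}
        = (Fintype.card α - X.card).factorial := by
      rw [← Fintype.card_congr (Equiv.Perm.subtypeEquivSubtypePerm fun a => a ∉ X),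
        Fintype.card_perm, Fintype.card_subtype_compl, Fintype.card_coe]
    rw [← hcard, ← Fintype.card_coe]
    refine Fintype.card_le_of_injective
      (fun π => ⟨π₀⁻¹ * π.1, fun a ha => ?_⟩) fun π π' hπ => ?_
    · have ha' : a ∈ X := not_not.mp ha
      have := (Finset.mem_filter.mp π.2).2 a ha'
      rw [Equiv.Perm.mul_apply, this, ← h₀ a ha']
      exact π₀.symm_apply_apply a
    · exact Subtype.ext (mul_left_cancel (congrArg Subtype.val hπ))
  · rw [Finset.filter_false_of_mem fun π _ hπ => h ⟨π, hπ⟩]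
    simp

/-- Factor by factor, `(K - i) / (N - i) ≤ K / N`: sampling without replacement is no likelier to
stay inside a subset than sampling with replacement. -/
theorem Nat.descFactorial_mul_pow_le {K N : ℕ} (h : K ≤ N) (b : ℕ) :
    K.descFactorial b * N ^ b ≤ K ^ b * N.descFactorial b := by
  induction b with
  | zero => simp
  | succ b ih =>
    have key : (K - b) * N ≤ K * (N - b) := by
      rw [Nat.sub_mul, Nat.mul_sub, Nat.mul_comm K b]
      have := Nat.mul_le_mul_left b h
      omega
    calc K.descFactorial (b + 1) * N ^ (b + 1)
        = ((K - b) * N) * (K.descFactorial b * N ^ b) := by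
          rw [Nat.descFactorial_succ]; ring
      _ ≤ (K * (N - b)) * (K ^ b * N.descFactorial b) := Nat.mul_le_mul key ih
      _ = K ^ (b + 1) * N.descFactorial (b + 1) := by
          rw [Nat.descFactorial_succ]; ring

/-- A uniformly random permutation maps `X` into `Y` with probability at most
`(|Y| / N) ^ |X|`. -/
theorem Equiv.Perm.card_filter_mapsTo_le (X Y : Finset α) :
    (Finset.univ.filter fun π : Equiv.Perm α => ∀ x ∈ X, π x ∈ Y).card
        * Fintype.card α ^ X.card
      ≤ Y.card ^ X.card * (Fintype.card α).factorial := by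
  classical
  have hcount : (Finset.univ.filter fun π : Equiv.Perm α => ∀ x ∈ X, π x ∈ Y).card
      ≤ (Fintype.card α - X.card).factorial * Y.card.descFactorial X.card := by
    have hemb : Y.card.descFactorial X.card = (Finset.univ : Finset (X ↪ Y)).card := by
      rw [Finset.card_univ, Fintype.card_embedding_eq, Fintype.card_coe, Fintype.card_coe]
    rw [hemb]
    have hsub : (Finset.univ.filter fun π : Equiv.Perm α => ∀ x ∈ X, π x ∈ Y) ⊆
        (Finset.univ : Finset (X ↪ Y)).biUnion fun f =>
          Finset.univ.filter fun π : Equiv.Perm α =>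
            ∀ x ∈ X, π x = if h : x ∈ X then (f ⟨x, h⟩ : α) else x := by
      intro π hπ
      have hπ := (Finset.mem_filter.mp hπ).2
      refine Finset.mem_biUnion.mpr ⟨⟨fun x => ⟨π x, hπ x x.2⟩, fun x y hxy => ?_⟩,
        Finset.mem_univ _, ?_⟩
      · exact Subtype.ext (π.injective (congrArg Subtype.val hxy))
      · refine Finset.mem_filter.mpr ⟨Finset.mem_univ _, fun x hx => ?_⟩
        rw [dif_pos hx]
        rfl
    refine (Finset.card_le_card hsub).trans (Finset.card_biUnion_le.trans ?_)
    refine (Finset.sum_le_card_nsmul _ _ _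
      fun f _ => Equiv.Perm.card_filter_eqOn_le X _).trans (le_of_eq ?_)
    rw [smul_eq_mul, Nat.mul_comm]
  have hX : X.card ≤ Fintype.card α := Finset.card_le_univ X
  calc _ ≤ (Fintype.card α - X.card).factorial * Y.card.descFactorial X.card
        * Fintype.card α ^ X.card := Nat.mul_le_mul_right _ hcount
    _ = (Fintype.card α - X.card).factorial
        * (Y.card.descFactorial X.card * Fintype.card α ^ X.card) := by ring
    _ ≤ (Fintype.card α - X.card).factorial
        * (Y.card ^ X.card * (Fintype.card α).descFactorial X.card) :=
        Nat.mul_le_mul_left _ (Nat.descFactorial_mul_pow_le (Finset.card_le_univ Y) _)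
    _ = Y.card ^ X.card * (Fintype.card α).factorial := by
        rw [← Nat.factorial_mul_descFactorial hX]; ring

theorem Equiv.Perm.card_filter_apply_eq_le (x a : α) :
    (Finset.univ.filter fun π : Equiv.Perm α => π x = a).card
      ≤ (Fintype.card α - 1).factorial := by
  simpa using Equiv.Perm.card_filter_eqOn_le {x} fun _ => a

theorem Equiv.Perm.card_filter_apply_eq_apply_eq_le {x y : α} (h : x ≠ y) (a b : α) :
    (Finset.univ.filter fun π : Equiv.Perm α => π x = a ∧ π y = b).card
      ≤ (Fintype.card α - 2).factorial := by
  have := Equiv.Perm.card_filter_eqOn_le {x, y} fun z => if z = x then a else b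
  simpa [Finset.card_pair h, h.symm] using this

end PermCounting

/-! ### Directed cycles and initial segments of acyclic sets. -/

namespace Digraph

/-- A digraph on a nonempty finite vertex set all of whose vertices have an in-neighbour
contains a directed cycle. -/
theorem hasDirectedCycle_of_forall_exists_adj {V : Type*} [Finite V] [Nonempty V]
    (D : Digraph V) (h : ∀ v, ∃ u, D.Adj u v) : D.HasDirectedCycle := by
  choose p hp using h
  obtain ⟨v₀⟩ := ‹Nonempty V›
  obtain ⟨a, b, hab, heq⟩ := Finite.exists_ne_map_eq_of_infinite fun k : ℕ => p^[k] v₀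
  obtain ⟨x, hx⟩ : ∃ x, x ∈ Function.periodicPts p := by
    wlog hlt : a < b generalizing a b
    · exact this b a hab.symm heq.symm (lt_of_le_of_ne (not_lt.mp hlt) hab.symm)
    refine ⟨p^[a] v₀, Function.mk_mem_periodicPts (n := b - a) (by omega) ?_⟩
    change p^[b - a] (p^[a] v₀) = p^[a] v₀
    rw [← Function.iterate_add_apply, Nat.sub_add_cancel hlt.le]
    exact heq.symm
  have hpos := Function.minimalPeriod_pos_of_mem_periodicPts hx
  obtain ⟨k, hk⟩ : ∃ k, Function.minimalPeriod p x = k + 1 := ⟨_, (Nat.succ_pred hpos.ne').symm⟩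
  have hper : p^[k + 1] x = x := hk ▸ Function.iterate_minimalPeriod
  -- `p` steps to an in-neighbour, so its orbit is traversed backwards to follow the arcs.
  refine ⟨k, fun i => p^[k - i] x, fun i j hij => ?_, fun i => ?_⟩
  · have := Function.iterate_injOn_Iio_minimalPeriod (f := p) (x := x)
      (Set.mem_Iio.mpr (by omega : k - i < _)) (Set.mem_Iio.mpr (by omega : k - j < _)) hij
    exact Fin.ext (by omega)
  · rcases eq_or_ne i (Fin.last k) with rfl | hi
    · have h0 : D.Adj (p x) x := hp x
      have : (Fin.last k + 1 : Fin (k + 1)) = 0 := Fin.last_add_one k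
      simp only [this, Fin.val_last, Nat.sub_self, Function.iterate_zero, id, Fin.val_zero,
        Nat.sub_zero]
      have h1 := hp (p^[k] x)
      rwa [← Function.iterate_succ_apply' p k x, hper] at h1
    · have hlt : (i : ℕ) < k := by
        have := Fin.val_lt_last hi
        simpa using this
      have hv : ((i + 1 : Fin (k + 1)) : ℕ) = i + 1 := Fin.val_add_one_of_lt (Fin.lt_last_iff_ne_last.mpr hi)
      simp only [hv]
      have : k - (i : ℕ) = (k - (i + 1)) + 1 := by omega
      rw [this, Function.iterate_succ_apply']
      exact hp _

theorem IsAcyclicSet.mono {V : Type*} {D : Digraph V} {S S' : Set V}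
    (h : D.IsAcyclicSet S) (hS : S' ⊆ S) : D.IsAcyclicSet S' := by
  rintro ⟨k, c, hc, hadj⟩
  exact h ⟨k, fun i => ⟨c i, hS (c i).2⟩,
    fun i j hij => hc (Subtype.ext (Subtype.mk.inj hij)), hadj⟩

/-- An acyclic set has initial segments (for a topological order) of all sizes. -/
theorem IsAcyclicSet.exists_initial {V : Type*} [DecidableEq V] {D : Digraph V} {S : Finset V}
    (h : D.IsAcyclicSet (S : Set V)) {b : ℕ} (hb : b ≤ S.card) :
    ∃ B ⊆ S, B.card = b ∧ ∀ v ∈ B, ∀ u ∈ S, D.Adj u v → u ∈ B := by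
  induction b with
  | zero => exact ⟨∅, Finset.empty_subset _, rfl, by simp⟩
  | succ b ih =>
    obtain ⟨B, hBS, hBc, hB⟩ := ih (by omega)
    -- A source of what remains of `S` extends the segment; without one, every remaining vertex has
    -- a remaining in-neighbour, which forces a cycle.
    obtain ⟨v, hv, hsrc⟩ : ∃ v ∈ S \ B, ∀ u ∈ S \ B, ¬ D.Adj u v := by
      by_contra! hcon
      have hne : (S \ B).Nonempty := by
        rw [← Finset.card_pos, Finset.card_sdiff_of_subset hBS]
        omega
      have : Nonempty ((S \ B : Finset V) : Set V) := hne.to_subtype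
      have : Finite ((S \ B : Finset V) : Set V) := (S \ B).finite_toSet
      refine h.mono (S' := ((S \ B : Finset V) : Set V))
        (by exact_mod_cast Finset.sdiff_subset)
        (hasDirectedCycle_of_forall_exists_adj _ fun v => ?_)
      obtain ⟨u, hu, huv⟩ := hcon v.1 v.2
      exact ⟨⟨u, hu⟩, huv⟩
    obtain ⟨hvS, hvB⟩ := Finset.mem_sdiff.mp hv
    refine ⟨insert v B, Finset.insert_subset hvS hBS, by rw [Finset.card_insert_of_notMem hvB, hBc],
      fun w hw u hu huw => ?_⟩
    rcases Finset.mem_insert.mp hw with rfl | hw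
    · by_contra hcon
      exact hsrc u (Finset.mem_sdiff.mpr
        ⟨hu, fun h => hcon (Finset.mem_insert_of_mem h)⟩) huw
    · exact Finset.mem_insert_of_mem (hB w hw u hu huw)

end Digraph

/-! ### The configuration model and its fibres. -/

namespace Digraph

variable {V : Type*} {r : ℕ}

/-- The digraph of a configuration: every vertex `v` has `r` out-stubs and `r` in-stubs `(v, i)`,
and the bijection `π` joins each out-stub to an in-stub. -/
def ofConfig (π : Equiv.Perm (V × Fin r)) : Digraph V where
  Adj u v := ∃ i, (π (u, i)).1 = v

theorem ofConfig_adj {π : Equiv.Perm (V × Fin r)} {u v : V} :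
    (ofConfig π).Adj u v ↔ ∃ i, (π (u, i)).1 = v := Iff.rfl

theorem ofConfig_adj_apply (π : Equiv.Perm (V × Fin r)) (x : V × Fin r) :
    (ofConfig π).Adj x.1 (π x).1 := ⟨x.2, rfl⟩

theorem ofConfig_adj_iff_symm {π : Equiv.Perm (V × Fin r)} {u v : V} :
    (ofConfig π).Adj u v ↔ ∃ j, (π.symm (v, j)).1 = u := by
  constructor
  · rintro ⟨i, rfl⟩
    exact ⟨(π (u, i)).2, by simp⟩
  · rintro ⟨j, rfl⟩
    exact ⟨(π.symm (v, j)).2, by simp⟩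

theorem IsRegularDigraph.card_out {D : Digraph V} (hD : D.IsRegularDigraph r) (v : V)
    [Fintype {w // D.Adj v w}] : Fintype.card {w // D.Adj v w} = r := by
  rw [← Nat.card_eq_fintype_card]
  exact (hD v).1

theorem IsRegularDigraph.card_in {D : Digraph V} (hD : D.IsRegularDigraph r) (v : V)
    [Fintype {w // D.Adj w v}] : Fintype.card {w // D.Adj w v} = r := by
  rw [← Nat.card_eq_fintype_card]
  exact (hD v).2

theorem adj_iff_of_ofConfig_eq {π : Equiv.Perm (V × Fin r)} {D : Digraph V} (h : ofConfig π = D)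
    {u v : V} : D.Adj u v ↔ ∃ i, (π (u, i)).1 = v := by
  rw [← h, ofConfig_adj]

theorem adj_iff_symm_of_ofConfig_eq {π : Equiv.Perm (V × Fin r)} {D : Digraph V}
    (h : ofConfig π = D) {u v : V} : D.Adj u v ↔ ∃ j, (π.symm (v, j)).1 = u := by
  rw [← h, ofConfig_adj_iff_symm]

/-- Moves a labelling between vertices that are only propositionally equal, as needed for the
inverse laws in `configEquiv`. -/
theorem labelling_symm_congr {P : V → V → Prop} (f : ∀ u, Fin r ≃ {w // P u w}) {u u' w w' : V}
    (hu : u' = u) (hw : w' = w) (h : P u w) (h' : P u' w') :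
    (f u').symm ⟨w', h'⟩ = (f u).symm ⟨w, h⟩ := by
  subst hu hw
  rfl

section Fibre

variable [Fintype V]

open Classical in
/-- A configuration of a regular digraph `D` amounts to a labelling of the out-neighbours and of
the in-neighbours of every vertex. -/
noncomputable def configEquiv {D : Digraph V} (hD : D.IsRegularDigraph r) :
    {π : Equiv.Perm (V × Fin r) // ofConfig π = D} ≃
      (∀ u, Fin r ≃ {w // D.Adj u w}) × (∀ v, Fin r ≃ {w // D.Adj w v}) where
  toFun π :=
    (fun u => Equiv.ofBijective
        (fun i => ⟨(π.1 (u, i)).1, (adj_iff_of_ofConfig_eq π.2).mpr ⟨i, rfl⟩⟩)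
        ((Fintype.bijective_iff_surjective_and_card _).mpr
          ⟨fun w => by
            obtain ⟨i, hi⟩ := (adj_iff_of_ofConfig_eq π.2).mp w.2
            exact ⟨i, Subtype.ext hi⟩, by rw [hD.card_out, Fintype.card_fin]⟩),
      fun v => Equiv.ofBijective
        (fun j => ⟨(π.1.symm (v, j)).1, (adj_iff_symm_of_ofConfig_eq π.2).mpr ⟨j, rfl⟩⟩)
        ((Fintype.bijective_iff_surjective_and_card _).mpr
          ⟨fun w => by
            obtain ⟨i, hi⟩ := (adj_iff_symm_of_ofConfig_eq π.2).mp w.2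
            exact ⟨i, Subtype.ext hi⟩, by rw [hD.card_in, Fintype.card_fin]⟩))
  invFun L :=
    ⟨{ toFun := fun x => ((L.1 x.1 x.2).1, (L.2 (L.1 x.1 x.2).1).symm ⟨x.1, (L.1 x.1 x.2).2⟩)
       invFun := fun y => ((L.2 y.1 y.2).1, (L.1 (L.2 y.1 y.2).1).symm ⟨y.1, (L.2 y.1 y.2).2⟩)
       left_inv := fun x => Prod.ext (by simp)
         ((labelling_symm_congr L.1 (by simp) rfl (L.1 x.1 x.2).2 _).trans (by simp))
       right_inv := fun y => Prod.ext (by simp)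
         ((labelling_symm_congr L.2 (by simp) rfl (L.2 y.1 y.2).2 _).trans (by simp)) },
      by
        ext u v
        constructor
        · rintro ⟨i, rfl⟩
          exact (L.1 u i).2
        · intro h
          exact ⟨(L.1 u).symm ⟨v, h⟩, by simp⟩⟩
  left_inv π := by
    refine Subtype.ext (Equiv.ext fun x => ?_)
    refine Prod.ext rfl ?_
    refine (Equiv.symm_apply_eq _).mpr (Subtype.ext ?_)
    change x.1 = (π.1.symm (π.1 x)).1
    rw [Equiv.symm_apply_apply]
  right_inv L := by
    refine Prod.ext (funext fun u => Equiv.ext fun i => rfl)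
      (funext fun v => Equiv.ext fun j => rfl)

-- The `r !` labellings on each side of each vertex are chosen independently. The count does not
-- depend on `D`, which is what makes the model uniform on regular digraphs.
open Classical in
theorem card_filter_ofConfig_eq [DecidableEq V] {D : Digraph V} (hD : D.IsRegularDigraph r) :
    (Finset.univ.filter fun π : Equiv.Perm (V × Fin r) => ofConfig π = D).card
      = r.factorial ^ Fintype.card V * r.factorial ^ Fintype.card V := by
  rw [← Fintype.card_subtype, Fintype.card_congr (configEquiv hD), Fintype.card_prod,
    Fintype.card_pi, Fintype.card_pi]
  have h1 (u : V) : Fintype.card (Fin r ≃ {w // D.Adj u w}) = r.factorial := by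
    rw [Fintype.card_equiv (Fintype.equivOfCardEq (by rw [hD.card_out, Fintype.card_fin])),
      Fintype.card_fin]
  have h2 (u : V) : Fintype.card (Fin r ≃ {w // D.Adj w u}) = r.factorial := by
    rw [Fintype.card_equiv (Fintype.equivOfCardEq (by rw [hD.card_in, Fintype.card_fin])),
      Fintype.card_fin]
  simp [h1, h2]

open Classical in
/-- A set of regular digraphs has the same number of configurations for each of its members. -/
theorem card_filter_ofConfig_mem [DecidableEq V] (A : Finset (Digraph V))
    (hA : ∀ D ∈ A, D.IsRegularDigraph r) :
    (Finset.univ.filter fun π : Equiv.Perm (V × Fin r) => ofConfig π ∈ A).card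
      = A.card * (r.factorial ^ Fintype.card V * r.factorial ^ Fintype.card V) := by
  have hmaps : Set.MapsTo ofConfig
      ((Finset.univ.filter fun π : Equiv.Perm (V × Fin r) => ofConfig π ∈ A :
        Finset (Equiv.Perm (V × Fin r))) : Set (Equiv.Perm (V × Fin r))) (A : Set (Digraph V)) :=
    fun π hπ => (Finset.mem_filter.mp hπ).2
  rw [Finset.card_eq_sum_card_fiberwise hmaps]
  refine Finset.sum_const_nat ?_
  intro D hD
  rw [← card_filter_ofConfig_eq (hA D hD), Finset.filter_filter]
  congr 1
  ext π
  simp only [Finset.mem_filter, Finset.mem_univ, true_and, and_iff_right_iff_imp]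
  rintro rfl
  exact hD

end Fibre

/-- The out-stubs `x` and `y` are joined to in-stubs by parallel or by opposite arcs. -/
def ConfigConflict (π : Equiv.Perm (V × Fin r)) (x y : V × Fin r) : Prop :=
  (x.1 = y.1 ∧ (π x).1 = (π y).1) ∨ ((π x).1 = y.1 ∧ (π y).1 = x.1)

/-- The arc at the out-stub `x` is a loop, or parallel or opposite to another arc. -/
def IsBadStub (π : Equiv.Perm (V × Fin r)) (x : V × Fin r) : Prop :=
  (π x).1 = x.1 ∨ ∃ y, y ≠ x ∧ ConfigConflict π x y

theorem ofConfig_isOrientedGraph {π : Equiv.Perm (V × Fin r)} (h : ∀ x, ¬ IsBadStub π x) :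
    (ofConfig π).IsOrientedGraph := by
  refine ⟨fun v ⟨i, hi⟩ => h (v, i) (Or.inl hi), ?_⟩
  rintro u v ⟨i, hi⟩ ⟨j, hj⟩
  by_cases huv : u = v
  · subst huv
    exact h (u, i) (Or.inl hi)
  · exact h (u, i) (Or.inr ⟨(v, j), fun h => huv (congrArg Prod.fst h).symm, Or.inr ⟨hi, hj⟩⟩)

theorem ofConfig_isRegularDigraph {π : Equiv.Perm (V × Fin r)} (h : ∀ x, ¬ IsBadStub π x) :
    (ofConfig π).IsRegularDigraph r := by
  intro v
  constructor
  · have : {w | (ofConfig π).Adj v w} = Set.range fun i => (π (v, i)).1 := rfl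
    rw [this, Set.ncard_range_of_injective, Nat.card_eq_fintype_card, Fintype.card_fin]
    intro i j hij
    by_contra hne
    exact h (v, i) (Or.inr ⟨(v, j), fun h => hne (congrArg Prod.snd h).symm, Or.inl ⟨rfl, hij⟩⟩)
  · have : {w | (ofConfig π).Adj w v} = Set.range fun j => (π.symm (v, j)).1 :=
      Set.ext fun w => ofConfig_adj_iff_symm
    rw [this, Set.ncard_range_of_injective, Nat.card_eq_fintype_card, Fintype.card_fin]
    intro i j hij
    by_contra hne
    refine h (π.symm (v, i)) (Or.inr ⟨π.symm (v, j), fun h => hne ?_, Or.inl ⟨hij, by simp⟩⟩)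
    exact (congrArg Prod.snd (π.symm.injective h)).symm

end Digraph

/-! ### Switching away loops, parallel arcs and opposite arcs. -/

namespace Digraph

variable {V : Type*} {r : ℕ}

theorem ConfigConflict.symm {π : Equiv.Perm (V × Fin r)} {x y : V × Fin r}
    (h : ConfigConflict π x y) : ConfigConflict π y x := by
  rcases h with ⟨h1, h2⟩ | ⟨h1, h2⟩
  · exact Or.inl ⟨h1.symm, h2.symm⟩
  · exact Or.inr ⟨h2, h1⟩

section Switching

variable [DecidableEq V]

/-- The vertices `u` and `v` and all their neighbours in a configuration. -/
def configNbhd (π : Equiv.Perm (V × Fin r)) (u v : V) : Finset V :=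
  {u, v} ∪ ((({u, v} : Finset V) ×ˢ Finset.univ).image fun z => (π z).1) ∪
    ((({u, v} : Finset V) ×ˢ Finset.univ).image fun z => (π.symm z).1)

theorem card_configNbhd_le (π : Equiv.Perm (V × Fin r)) (u v : V) :
    (configNbhd π u v).card ≤ 4 * r + 2 := by
  have h2 : ({u, v} : Finset V).card ≤ 2 := Finset.card_le_two
  have hp : (({u, v} : Finset V) ×ˢ (Finset.univ : Finset (Fin r))).card ≤ 2 * r := by
    rw [Finset.card_product, Finset.card_univ, Fintype.card_fin]
    exact Nat.mul_le_mul_right _ h2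
  refine (Finset.card_union_le _ _).trans ?_
  have h3 := Finset.card_union_le ({u, v} : Finset V)
    ((({u, v} : Finset V) ×ˢ Finset.univ).image fun z => (π z).1)
  have h4 := Finset.card_image_le (s := ({u, v} : Finset V) ×ˢ (Finset.univ : Finset (Fin r)))
    (f := fun z => (π z).1)
  have h5 := Finset.card_image_le (s := ({u, v} : Finset V) ×ˢ (Finset.univ : Finset (Fin r)))
    (f := fun z => (π.symm z).1)
  omega

theorem left_mem_configNbhd (π : Equiv.Perm (V × Fin r)) (u v : V) : u ∈ configNbhd π u v := by
  simp [configNbhd]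

theorem right_mem_configNbhd (π : Equiv.Perm (V × Fin r)) (u v : V) : v ∈ configNbhd π u v := by
  simp [configNbhd]

theorem apply_mem_configNbhd {π : Equiv.Perm (V × Fin r)} {u v : V} {z : V × Fin r}
    (h : z.1 = u ∨ z.1 = v) : (π z).1 ∈ configNbhd π u v := by
  refine Finset.mem_union_left _ (Finset.mem_union_right _
    (Finset.mem_image.mpr ⟨z, ?_, rfl⟩))
  simpa using h

theorem mem_configNbhd_of_apply {π : Equiv.Perm (V × Fin r)} {u v : V} {z : V × Fin r}
    (h : (π z).1 = u ∨ (π z).1 = v) : z.1 ∈ configNbhd π u v := by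
  refine Finset.mem_union_right _ (Finset.mem_image.mpr ⟨π z, ?_, by simp⟩)
  simpa using h

/-- Switching the arcs at a bad out-stub `x` and a good, distant out-stub `y` makes `x` good and
creates no new bad out-stub. -/
theorem isBadStub_of_isBadStub_mul_swap {π : Equiv.Perm (V × Fin r)} {x y : V × Fin r}
    (hy : ¬ IsBadStub π y) (hy₁ : y.1 ∉ configNbhd π x.1 (π x).1)
    (hy₂ : (π y).1 ∉ configNbhd π x.1 (π x).1) {z : V × Fin r}
    (hz : IsBadStub (π * Equiv.swap x y) z) : z ≠ x ∧ IsBadStub π z := by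
  have hxy : y ≠ x := by
    rintro rfl
    exact hy₁ (left_mem_configNbhd _ _ _)
  have hyl : (π y).1 ≠ y.1 := fun h => hy (Or.inl h)
  have hx' : (π * Equiv.swap x y) x = π y := by simp
  have hy' : (π * Equiv.swap x y) y = π x := by simp
  have ho (w : V × Fin r) (h1 : w ≠ x) (h2 : w ≠ y) : (π * Equiv.swap x y) w = π w := by
    simp [Equiv.swap_apply_of_ne_of_ne h1 h2]
  have n1 : y.1 ≠ x.1 := fun h => hy₁ (h ▸ left_mem_configNbhd _ _ _)
  have n2 : y.1 ≠ (π x).1 := fun h => hy₁ (h ▸ right_mem_configNbhd _ _ _)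
  have n3 : (π y).1 ≠ x.1 := fun h => hy₂ (h ▸ left_mem_configNbhd _ _ _)
  have n4 : (π y).1 ≠ (π x).1 := fun h => hy₂ (h ▸ right_mem_configNbhd _ _ _)
  -- No arc runs in either direction between the ends of the arc at `x` and those of the arc at `y`.
  -- The two new arcs join just such pairs, so no untouched arc can be parallel or opposite to them.
  have o1 (w : V × Fin r) (h : w.1 = x.1 ∨ w.1 = (π x).1) : (π w).1 ≠ y.1 ∧ (π w).1 ≠ (π y).1 :=
    ⟨fun e => hy₁ (e ▸ apply_mem_configNbhd h), fun e => hy₂ (e ▸ apply_mem_configNbhd h)⟩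
  have o2 (w : V × Fin r) (h : (π w).1 = x.1 ∨ (π w).1 = (π x).1) :
      w.1 ≠ y.1 ∧ w.1 ≠ (π y).1 :=
    ⟨fun e => hy₁ (e ▸ mem_configNbhd_of_apply h), fun e => hy₂ (e ▸ mem_configNbhd_of_apply h)⟩
  have cxy : ¬ ConfigConflict (π * Equiv.swap x y) x y := by
    rintro (⟨h1, -⟩ | ⟨h1, -⟩)
    · exact n1 h1.symm
    · rw [hx'] at h1
      exact hyl h1
  have cx (w : V × Fin r) (h1 : w ≠ x) (h2 : w ≠ y) :
      ¬ ConfigConflict (π * Equiv.swap x y) x w := by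
    unfold ConfigConflict
    rw [hx', ho w h1 h2]
    rintro (⟨h1, h2⟩ | ⟨h1, h2⟩)
    · exact (o1 w (Or.inl h1.symm)).2 h2.symm
    · exact (o2 w (Or.inl h2)).2 h1.symm
  have cy (w : V × Fin r) (h1 : w ≠ x) (h2 : w ≠ y) :
      ¬ ConfigConflict (π * Equiv.swap x y) y w := by
    unfold ConfigConflict
    rw [hy', ho w h1 h2]
    rintro (⟨h1, h2⟩ | ⟨h1, h2⟩)
    · exact (o2 w (Or.inr h2.symm)).1 h1.symm
    · exact (o1 w (Or.inr h1.symm)).1 h2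
  have bx : ¬ IsBadStub (π * Equiv.swap x y) x := by
    rintro (h | ⟨w, hw, hc⟩)
    · rw [hx'] at h
      exact n3 h
    · by_cases hwy : w = y
      · exact cxy (hwy ▸ hc)
      · exact cx w hw hwy hc
  have by' : ¬ IsBadStub (π * Equiv.swap x y) y := by
    rintro (h | ⟨w, hw, hc⟩)
    · rw [hy'] at h
      exact n2 h.symm
    · by_cases hwx : w = x
      · exact cxy (hwx ▸ hc.symm)
      · exact cy w hwx hw hc
  have zx : z ≠ x := fun h => bx (h ▸ hz)
  have zy : z ≠ y := fun h => by' (h ▸ hz)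
  refine ⟨zx, ?_⟩
  rcases hz with h | ⟨w, hw, hc⟩
  · rw [ho z zx zy] at h
    exact Or.inl h
  · have wx : w ≠ x := fun h => cx z zx zy (h ▸ hc.symm)
    have wy : w ≠ y := fun h => cy z zx zy (h ▸ hc.symm)
    refine Or.inr ⟨w, hw, ?_⟩
    unfold ConfigConflict at hc ⊢
    rwa [ho z zx zy, ho w wx wy] at hc

end Switching

variable [Fintype V]

open Classical in
/-- The set of bad out-stubs of a configuration. -/
noncomputable def badStubs (π : Equiv.Perm (V × Fin r)) : Finset (V × Fin r) :=
  Finset.univ.filter (IsBadStub π)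

theorem mem_badStubs {π : Equiv.Perm (V × Fin r)} {x : V × Fin r} :
    x ∈ badStubs π ↔ IsBadStub π x := by
  simp [badStubs]

variable [DecidableEq V]

/-- The neighbourhood carries at most `(4 * r + 2) * r` out-stubs and as many in-stubs; these and
the bad stubs do not exhaust all stubs. -/
theorem exists_good_distant_stub (π : Equiv.Perm (V × Fin r)) (u v : V)
    (h : 2 * ((4 * r + 2) * r) + (badStubs π).card < Fintype.card V * r) :
    ∃ y, ¬ IsBadStub π y ∧ y.1 ∉ configNbhd π u v ∧ (π y).1 ∉ configNbhd π u v := by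
  by_contra! hcon
  set S : Finset (V × Fin r) := configNbhd π u v ×ˢ Finset.univ with hS
  have hScard : S.card ≤ (4 * r + 2) * r := by
    rw [hS, Finset.card_product, Finset.card_univ, Fintype.card_fin]
    exact Nat.mul_le_mul_right _ (card_configNbhd_le π u v)
  have hcover : (Finset.univ : Finset (V × Fin r)) ⊆ (S ∪ S.image π.symm) ∪ badStubs π := by
    intro y _
    by_cases hb : IsBadStub π y
    · exact Finset.mem_union_right _ (mem_badStubs.mpr hb)
    · refine Finset.mem_union_left _ ?_
      by_cases hy : y.1 ∈ configNbhd π u v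
      · exact Finset.mem_union_left _ (by simp [hS, hy])
      · refine Finset.mem_union_right _ (Finset.mem_image.mpr ⟨π y, ?_, by simp⟩)
        simp [hS, hcon y hb hy]
  have h1 := Finset.card_le_card hcover
  have h2 := Finset.card_union_le (S ∪ S.image π.symm) (badStubs π)
  have h3 := Finset.card_union_le S (S.image π.symm)
  have h4 := Finset.card_image_le (s := S) (f := π.symm)
  rw [Finset.card_univ, Fintype.card_prod, Fintype.card_fin] at h1
  omega

theorem exists_card_badStubs_mul_swap_lt {π : Equiv.Perm (V × Fin r)} {x : V × Fin r}
    (hx : x ∈ badStubs π)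
    (h : 2 * ((4 * r + 2) * r) + (badStubs π).card < Fintype.card V * r) :
    ∃ y, (badStubs (π * Equiv.swap x y)).card < (badStubs π).card := by
  obtain ⟨y, hy, hy₁, hy₂⟩ := exists_good_distant_stub π x.1 (π x).1 h
  refine ⟨y, Finset.card_lt_card (Finset.ssubset_iff_of_subset ?_ |>.mpr ⟨x, hx, ?_⟩)⟩
  · intro z hz
    exact mem_badStubs.mpr (isBadStub_of_isBadStub_mul_swap hy hy₁ hy₂ (mem_badStubs.mp hz)).2
  · intro hz
    exact (isBadStub_of_isBadStub_mul_swap hy hy₁ hy₂ (mem_badStubs.mp hz)).1 rfl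

/-- A transposition is its own inverse, so a configuration is recovered from the switched one and
the pair `(x, y)`. -/
theorem card_badStubs_le_succ_le {b : ℕ}
    (h : 2 * ((4 * r + 2) * r) + (b + 1) < Fintype.card V * r) :
    (Finset.univ.filter fun π : Equiv.Perm (V × Fin r) => (badStubs π).card ≤ b + 1).card
      ≤ (Finset.univ.filter fun π : Equiv.Perm (V × Fin r) => (badStubs π).card ≤ b).card
        * (Fintype.card V * r) ^ 2 := by
  classical
  have hN : Fintype.card (V × Fin r) = Fintype.card V * r := by simp
  have hsub : (Finset.univ.filter fun π : Equiv.Perm (V × Fin r) => (badStubs π).card ≤ b + 1) ⊆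
      ((Finset.univ.filter fun π : Equiv.Perm (V × Fin r) => (badStubs π).card ≤ b) ×ˢ
        ((Finset.univ : Finset (V × Fin r)) ×ˢ (Finset.univ : Finset (V × Fin r)))).image
        fun p => p.1 * Equiv.swap p.2.1 p.2.2 := by
    intro π hπ
    have hπ := (Finset.mem_filter.mp hπ).2
    suffices ∃ x y, (badStubs (π * Equiv.swap x y)).card ≤ b by
      obtain ⟨x, y, hxy⟩ := this
      exact Finset.mem_image.mpr ⟨(π * Equiv.swap x y, x, y), by simpa using hxy,
        by simp [mul_assoc]⟩
    -- If no switching is needed, the trivial swap with `x = y` serves.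
    by_cases hb : (badStubs π).card ≤ b
    · have : 0 < Fintype.card (V × Fin r) := by omega
      obtain ⟨x⟩ := Fintype.card_pos_iff.mp this
      exact ⟨x, x, by rwa [Equiv.swap_self, ← Equiv.Perm.one_def, mul_one]⟩
    · obtain ⟨x, hx⟩ : (badStubs π).Nonempty := Finset.card_pos.mp (by omega)
      obtain ⟨y, hy⟩ := exists_card_badStubs_mul_swap_lt hx (by omega)
      exact ⟨x, y, by omega⟩
  refine (Finset.card_le_card hsub).trans (Finset.card_image_le.trans (le_of_eq ?_))
  rw [Finset.card_product, Finset.card_product, Finset.card_univ, hN, sq]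

theorem card_badStubs_le_le {b : ℕ}
    (h : 2 * ((4 * r + 2) * r) + b < Fintype.card V * r) :
    (Finset.univ.filter fun π : Equiv.Perm (V × Fin r) => (badStubs π).card ≤ b).card
      ≤ (Finset.univ.filter fun π : Equiv.Perm (V × Fin r) => (badStubs π).card ≤ 0).card
        * (Fintype.card V * r) ^ (2 * b) := by
  induction b with
  | zero => simp
  | succ b ih =>
    refine (card_badStubs_le_succ_le h).trans ?_
    refine (Nat.mul_le_mul_right _ (ih (by omega))).trans (le_of_eq ?_)
    ring

-- Union bound over the causes. A loop prescribes one value of `π`, in `r` ways. A parallel or an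
-- opposite arc prescribes two values, each in `n * r * r ^ 2` ways.
open Classical in
theorem card_filter_isBadStub_le (x : V × Fin r) :
    (Finset.univ.filter fun π : Equiv.Perm (V × Fin r) => IsBadStub π x).card
      ≤ r * (Fintype.card V * r - 1).factorial
        + 2 * (Fintype.card V * r * r ^ 2 * (Fintype.card V * r - 2).factorial) := by
  have hN : Fintype.card (V × Fin r) = Fintype.card V * r := by simp
  have hpair (y a b : V × Fin r) :
      (Finset.univ.filter fun π : Equiv.Perm (V × Fin r) => y ≠ x ∧ π x = a ∧ π y = b).card
        ≤ (Fintype.card V * r - 2).factorial := by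
    by_cases h : y ≠ x
    · simpa [h, hN] using Equiv.Perm.card_filter_apply_eq_apply_eq_le h.symm a b
    · simp [h]
  have hsub : (Finset.univ.filter fun π : Equiv.Perm (V × Fin r) => IsBadStub π x) ⊆
      ((Finset.univ : Finset (Fin r)).biUnion fun j =>
          Finset.univ.filter fun π : Equiv.Perm (V × Fin r) => π x = (x.1, j)) ∪
      (((Finset.univ : Finset (Fin r × V × Fin r × Fin r)).biUnion fun p =>
          Finset.univ.filter fun π : Equiv.Perm (V × Fin r) =>
            (x.1, p.1) ≠ x ∧ π x = (p.2.1, p.2.2.1) ∧ π (x.1, p.1) = (p.2.1, p.2.2.2)) ∪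
        ((Finset.univ : Finset ((V × Fin r) × Fin r × Fin r)).biUnion fun p =>
          Finset.univ.filter fun π : Equiv.Perm (V × Fin r) =>
            p.1 ≠ x ∧ π x = (p.1.1, p.2.1) ∧ π p.1 = (x.1, p.2.2))) := by
    intro π hπ
    rcases (Finset.mem_filter.mp hπ).2 with h | ⟨y, hy, ⟨h1, h2⟩ | ⟨h1, h2⟩⟩
    · refine Finset.mem_union_left _ (Finset.mem_biUnion.mpr ⟨(π x).2, Finset.mem_univ _, ?_⟩)
      exact Finset.mem_filter.mpr ⟨Finset.mem_univ _, Prod.ext h rfl⟩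
    · refine Finset.mem_union_right _ (Finset.mem_union_left _ (Finset.mem_biUnion.mpr
        ⟨(y.2, (π x).1, (π x).2, (π y).2), Finset.mem_univ _, ?_⟩))
      have hy' : (x.1, y.2) = y := Prod.ext h1 rfl
      refine Finset.mem_filter.mpr ⟨Finset.mem_univ _, ?_, rfl, ?_⟩
      · simpa only [hy'] using hy
      · simp only [hy']
        exact Prod.ext h2.symm rfl
    · refine Finset.mem_union_right _ (Finset.mem_union_right _ (Finset.mem_biUnion.mpr
        ⟨(y, (π x).2, (π y).2), Finset.mem_univ _, ?_⟩))
      exact Finset.mem_filter.mpr ⟨Finset.mem_univ _, hy, Prod.ext h1 rfl, Prod.ext h2 rfl⟩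
  refine (Finset.card_le_card hsub).trans ((Finset.card_union_le _ _).trans
    (Nat.add_le_add ?_ ((Finset.card_union_le _ _).trans ?_)))
  · refine Finset.card_biUnion_le.trans ((Finset.sum_le_card_nsmul _ _
      (Fintype.card V * r - 1).factorial fun j _ => ?_).trans (by simp))
    simpa [hN] using Equiv.Perm.card_filter_apply_eq_le x (x.1, j)
  · rw [two_mul]
    refine Nat.add_le_add ?_ ?_
    · refine Finset.card_biUnion_le.trans ((Finset.sum_le_card_nsmul _ _
        (Fintype.card V * r - 2).factorial fun p _ => hpair _ _ _).trans (le_of_eq ?_))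
      simp only [Finset.card_univ, Fintype.card_prod, Fintype.card_fin, smul_eq_mul]
      ring
    · refine Finset.card_biUnion_le.trans ((Finset.sum_le_card_nsmul _ _
        (Fintype.card V * r - 2).factorial fun p _ => hpair _ _ _).trans (le_of_eq ?_))
      simp only [Finset.card_univ, Fintype.card_prod, Fintype.card_fin, smul_eq_mul]
      ring

/-- The expected number of bad out-stubs of a random configuration is at most `5 r²`. -/
theorem sum_card_badStubs_le (hV : 2 ≤ Fintype.card V * r) :
    ∑ π : Equiv.Perm (V × Fin r), (badStubs π).card
      ≤ 5 * r ^ 2 * (Fintype.card V * r).factorial := by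
  classical
  have hswap : ∑ π : Equiv.Perm (V × Fin r), (badStubs π).card
      = ∑ x : V × Fin r,
        (Finset.univ.filter fun π : Equiv.Perm (V × Fin r) => IsBadStub π x).card := by
    simp only [badStubs, Finset.card_filter]
    exact Finset.sum_comm
  rw [hswap]
  refine (Finset.sum_le_card_nsmul _ _ _ fun x _ => card_filter_isBadStub_le x).trans ?_
  have hN : Fintype.card (V × Fin r) = Fintype.card V * r := by simp
  rw [Finset.card_univ, hN, smul_eq_mul]
  obtain ⟨m, hm⟩ : ∃ m, Fintype.card V * r = m + 2 := ⟨_, (Nat.sub_add_cancel hV).symm⟩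
  rw [hm, Nat.factorial_succ, Nat.factorial_succ, show m + 2 - 1 = m + 1 by omega,
    show m + 2 - 2 = m by omega, Nat.factorial_succ]
  have hr2 : r ≤ r ^ 2 := Nat.le_self_pow two_ne_zero r
  have h1 : (m + 2) * r * ((m + 1) * m.factorial)
      ≤ r ^ 2 * ((m + 2) * (m + 1) * m.factorial) := by
    calc _ = r * ((m + 2) * (m + 1) * m.factorial) := by ring
      _ ≤ _ := Nat.mul_le_mul_right _ hr2
  have h2 : (m + 2) * (m + 2) * (r ^ 2 * m.factorial)
      ≤ (m + 2) * (2 * (m + 1)) * (r ^ 2 * m.factorial) :=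
    Nat.mul_le_mul_right _ (Nat.mul_le_mul_left _ (by omega))
  nlinarith [h1, h2]

/-- All but a polynomially small proportion of configurations has no bad out-stub. -/
theorem factorial_le_card_badStubs_eq_zero (hr : 1 ≤ r)
    (h : 2 * ((4 * r + 2) * r) + 10 * r ^ 2 < Fintype.card V * r) :
    (Fintype.card V * r).factorial
      ≤ 2 * (Finset.univ.filter fun π : Equiv.Perm (V × Fin r) => (badStubs π).card ≤ 0).card
        * (Fintype.card V * r) ^ (20 * r ^ 2) := by
  classical
  have hr2 : 0 < r ^ 2 := by positivity
  -- Markov's inequality at twice the bound on the mean.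
  have hmarkov : 10 * r ^ 2 * (Finset.univ.filter fun π : Equiv.Perm (V × Fin r) =>
      ¬ (badStubs π).card ≤ 10 * r ^ 2).card ≤ 5 * r ^ 2 * (Fintype.card V * r).factorial := by
    refine le_trans ?_ (sum_card_badStubs_le (V := V) (by omega))
    rw [Nat.mul_comm, ← smul_eq_mul]
    refine (Finset.card_nsmul_le_sum _ (fun π => (badStubs π).card) _ fun π hπ => ?_).trans
      (Finset.sum_le_sum_of_subset (Finset.filter_subset _ _))
    exact (not_le.mp (Finset.mem_filter.mp hπ).2).le
  have hmarkov' : 2 * (Finset.univ.filter fun π : Equiv.Perm (V × Fin r) =>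
      ¬ (badStubs π).card ≤ 10 * r ^ 2).card ≤ (Fintype.card V * r).factorial := by
    refine Nat.le_of_mul_le_mul_left (c := 5 * r ^ 2) ?_ (by positivity)
    calc _ = 10 * r ^ 2 * _ := by ring
      _ ≤ _ := hmarkov
  have hsplit := Finset.card_filter_add_card_filter_not (s := Finset.univ)
    fun π : Equiv.Perm (V × Fin r) => (badStubs π).card ≤ 10 * r ^ 2
  rw [Finset.card_univ, Fintype.card_perm, Fintype.card_prod, Fintype.card_fin] at hsplit
  have hstep := card_badStubs_le_le (V := V) (r := r) (b := 10 * r ^ 2) h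
  calc (Fintype.card V * r).factorial
      ≤ 2 * (Finset.univ.filter fun π : Equiv.Perm (V × Fin r) =>
        (badStubs π).card ≤ 10 * r ^ 2).card := by omega
    _ ≤ _ := by
      rw [Nat.mul_assoc 2, show 20 * r ^ 2 = 2 * (10 * r ^ 2) by ring]
      exact Nat.mul_le_mul_left _ hstep

end Digraph

/-! ### First moment of large acyclic sets, and transfer to regular oriented graphs. -/

namespace Digraph

theorem exists_isAcyclicSet_card_eq {V : Type*} [Fintype V] {D : Digraph V} {m : ℕ}
    (h : m ≤ D.acyclicNumber) : ∃ S : Finset V, S.card = m ∧ D.IsAcyclicSet (S : Set V) := by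
  classical
  have hne : (Finset.univ.filter fun S : Finset V => D.IsAcyclicSet (S : Set V)).Nonempty := by
    refine ⟨∅, Finset.mem_filter.mpr ⟨Finset.mem_univ _, ?_⟩⟩
    rintro ⟨k, c, -, -⟩
    simpa using (c 0).2
  obtain ⟨S, hS, hcard⟩ := Finset.exists_mem_eq_sup _ hne Finset.card
  have hm : m ≤ S.card := by
    refine h.trans (le_of_eq ?_)
    rw [← hcard, acyclicNumber]
  obtain ⟨S', hS', hm'⟩ := Finset.exists_subset_card_eq hm
  exact ⟨S', hm', (Finset.mem_filter.mp hS).2.mono (by exact_mod_cast hS')⟩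

variable {V : Type*} [Fintype V] [DecidableEq V] {r : ℕ}

open Classical in
/-- First-moment bound for configurations with an acyclic set of `|V| - t` vertices: such a set
has an initial segment of `b` vertices whose in-arcs start in that segment or outside the set. -/
theorem card_filter_le_acyclicNumber_mul_le {t b : ℕ} (h : t + b ≤ Fintype.card V) :
    (Finset.univ.filter fun π : Equiv.Perm (V × Fin r) =>
        Fintype.card V - t ≤ (ofConfig π).acyclicNumber).card * (Fintype.card V * r) ^ (b * r)
      ≤ (Fintype.card V).choose t * (Fintype.card V).choose b *
        (((t + b) * r) ^ (b * r) * (Fintype.card V * r).factorial) := by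
  have hN : Fintype.card (V × Fin r) = Fintype.card V * r := by simp
  set P : Finset (Finset V × Finset V) :=
    Finset.powersetCard t Finset.univ ×ˢ Finset.powersetCard b Finset.univ with hP
  have hsub : (Finset.univ.filter fun π : Equiv.Perm (V × Fin r) =>
      Fintype.card V - t ≤ (ofConfig π).acyclicNumber) ⊆
      -- The pairs record the complement of the acyclic set and its initial segment.
      P.biUnion fun p => Finset.univ.filter fun π : Equiv.Perm (V × Fin r) =>
        ∀ y ∈ p.2 ×ˢ (Finset.univ : Finset (Fin r)),
          π⁻¹ y ∈ (p.1 ∪ p.2) ×ˢ (Finset.univ : Finset (Fin r)) := by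
    intro π hπ
    obtain ⟨S, hS, hac⟩ := exists_isAcyclicSet_card_eq (Finset.mem_filter.mp hπ).2
    obtain ⟨B, -, hB, hcl⟩ := hac.exists_initial (b := b) (by omega)
    refine Finset.mem_biUnion.mpr ⟨(Sᶜ, B), ?_, Finset.mem_filter.mpr ⟨Finset.mem_univ _, ?_⟩⟩
    · simp only [hP, Finset.mem_product, Finset.mem_powersetCard, Finset.subset_univ, true_and, hB,
        and_true, Finset.card_compl]
      omega
    · intro y hy
      have hy : y.1 ∈ B := (Finset.mem_product.mp hy).1
      refine Finset.mem_product.mpr ⟨?_, Finset.mem_univ _⟩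
      by_cases hx : (π⁻¹ y).1 ∈ S
      · refine Finset.mem_union_right _ (hcl y.1 hy _ hx ?_)
        have := ofConfig_adj_apply π (π⁻¹ y)
        rwa [show π (π⁻¹ y) = y from π.apply_symm_apply y] at this
      · exact Finset.mem_union_left _ (Finset.mem_compl.mpr hx)
  have hone (p : Finset V × Finset V) (hp : p ∈ P) :
      (Finset.univ.filter fun π : Equiv.Perm (V × Fin r) =>
        ∀ y ∈ p.2 ×ˢ (Finset.univ : Finset (Fin r)),
          π⁻¹ y ∈ (p.1 ∪ p.2) ×ˢ (Finset.univ : Finset (Fin r))).card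
        * (Fintype.card V * r) ^ (b * r)
      ≤ ((t + b) * r) ^ (b * r) * (Fintype.card V * r).factorial := by
    obtain ⟨h1, h2⟩ := Finset.mem_product.mp hp
    have h1 := (Finset.mem_powersetCard.mp h1).2
    have h2 := (Finset.mem_powersetCard.mp h2).2
    have hX : (p.2 ×ˢ (Finset.univ : Finset (Fin r))).card = b * r := by
      rw [Finset.card_product, h2, Finset.card_univ, Fintype.card_fin]
    have hY : ((p.1 ∪ p.2) ×ˢ (Finset.univ : Finset (Fin r))).card ≤ (t + b) * r := by
      rw [Finset.card_product, Finset.card_univ, Fintype.card_fin]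
      exact Nat.mul_le_mul_right _ ((Finset.card_union_le _ _).trans (by omega))
    have hinv : (Finset.univ.filter fun π : Equiv.Perm (V × Fin r) =>
        ∀ y ∈ p.2 ×ˢ (Finset.univ : Finset (Fin r)),
          π⁻¹ y ∈ (p.1 ∪ p.2) ×ˢ (Finset.univ : Finset (Fin r))).card ≤
        (Finset.univ.filter fun π : Equiv.Perm (V × Fin r) =>
        ∀ y ∈ p.2 ×ˢ (Finset.univ : Finset (Fin r)),
          π y ∈ (p.1 ∪ p.2) ×ˢ (Finset.univ : Finset (Fin r))).card :=
      Finset.card_le_card_of_injOn (fun π => π⁻¹)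
        (fun π hπ => Finset.mem_filter.mpr ⟨Finset.mem_univ _, (Finset.mem_filter.mp hπ).2⟩)
        inv_injective.injOn
    have hmaps := Equiv.Perm.card_filter_mapsTo_le (p.2 ×ˢ (Finset.univ : Finset (Fin r)))
      ((p.1 ∪ p.2) ×ˢ (Finset.univ : Finset (Fin r)))
    rw [hX, hN] at hmaps
    exact (Nat.mul_le_mul_right _ hinv).trans
      (hmaps.trans (Nat.mul_le_mul_right _ (Nat.pow_le_pow_left hY _)))
  have hPcard : P.card = (Fintype.card V).choose t * (Fintype.card V).choose b := by
    rw [hP, Finset.card_product, Finset.card_powersetCard, Finset.card_powersetCard,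
      Finset.card_univ]
  refine (Nat.mul_le_mul_right _ ((Finset.card_le_card hsub).trans
    Finset.card_biUnion_le)).trans ?_
  rw [Finset.sum_mul, ← hPcard, ← smul_eq_mul (a := P.card)]
  exact Finset.sum_le_card_nsmul _ _ _ hone

open Classical in
/-- The number of `r`-regular oriented graphs with an acyclic set of `|V| - t` vertices, compared
with the number of all `r`-regular oriented graphs. -/
theorem card_regular_le_acyclicNumber_mul_le {t b : ℕ} (hr : 1 ≤ r) (h : t + b ≤ Fintype.card V)
    (hV : 2 * ((4 * r + 2) * r) + 10 * r ^ 2 < Fintype.card V * r)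
    (R : Finset (Digraph V)) (hR : ∀ D, D ∈ R ↔ D.IsOrientedGraph ∧ D.IsRegularDigraph r) :
    0 < R.card ∧
    (R.filter fun D => Fintype.card V - t ≤ D.acyclicNumber).card * Fintype.card V ^ (b * r)
      ≤ (Fintype.card V).choose t * (Fintype.card V).choose b * (t + b) ^ (b * r) *
        (2 * (Fintype.card V * r) ^ (20 * r ^ 2)) * R.card := by
  set F := r.factorial ^ Fintype.card V * r.factorial ^ Fintype.card V with hF
  have hFpos : 0 < F := by positivity
  have hall := card_filter_ofConfig_mem R fun D hD => ((hR D).mp hD).2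
  have hsome := card_filter_ofConfig_mem (R.filter fun D => Fintype.card V - t ≤ D.acyclicNumber)
    fun D hD => ((hR D).mp (Finset.mem_filter.mp hD).1).2
  rw [← hF] at hall hsome
  have hgood : (Finset.univ.filter fun π : Equiv.Perm (V × Fin r) => (badStubs π).card ≤ 0).card
      ≤ R.card * F := by
    rw [← hall]
    refine Finset.card_le_card fun π hπ => Finset.mem_filter.mpr ⟨Finset.mem_univ _, ?_⟩
    have hb : badStubs π = ∅ := by simpa using (Finset.mem_filter.mp hπ).2
    have hb' (x) : ¬ IsBadStub π x := fun hx => by simpa [hb] using mem_badStubs.mpr hx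
    exact (hR _).mpr ⟨ofConfig_isOrientedGraph hb', ofConfig_isRegularDigraph hb'⟩
  have hfact : (Fintype.card V * r).factorial
      ≤ 2 * (R.card * F) * (Fintype.card V * r) ^ (20 * r ^ 2) :=
    (factorial_le_card_badStubs_eq_zero hr hV).trans
      (Nat.mul_le_mul_right _ (Nat.mul_le_mul_left _ hgood))
  refine ⟨Nat.pos_of_ne_zero fun h0 => ?_, ?_⟩
  · rw [h0] at hfact
    have := Nat.factorial_pos (Fintype.card V * r)
    simp at hfact
    omega
  have hbad : (R.filter fun D => Fintype.card V - t ≤ D.acyclicNumber).card * F ≤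
      (Finset.univ.filter fun π : Equiv.Perm (V × Fin r) =>
        Fintype.card V - t ≤ (ofConfig π).acyclicNumber).card := by
    rw [← hsome]
    exact Finset.card_le_card fun π hπ => Finset.mem_filter.mpr ⟨Finset.mem_univ _,
      (Finset.mem_filter.mp (Finset.mem_filter.mp hπ).2).2⟩
  have hmoment := card_filter_le_acyclicNumber_mul_le (r := r) h
  refine Nat.le_of_mul_le_mul_left (c := F * r ^ (b * r)) ?_ (by positivity)
  set n := Fintype.card V
  set E := (R.filter fun D => n - t ≤ D.acyclicNumber).card
  calc F * r ^ (b * r) * (E * n ^ (b * r)) = E * F * (n * r) ^ (b * r) := by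
        rw [mul_pow]; ring
    _ ≤ n.choose t * n.choose b * (((t + b) * r) ^ (b * r) * (n * r).factorial) :=
        (Nat.mul_le_mul_right _ hbad).trans hmoment
    _ ≤ n.choose t * n.choose b * (((t + b) * r) ^ (b * r) *
          (2 * (R.card * F) * (n * r) ^ (20 * r ^ 2))) := by gcongr
    _ = _ := by rw [mul_pow (t + b) r]; ring

end Digraph

/-! ### Entropy bounds and numerical estimates. -/

/-- The left side is a single term of the binomial expansion of `(x + (1 - x)) ^ n`. -/
theorem Nat.choose_mul_pow_mul_pow_le_one {x : ℝ} (h0 : 0 ≤ x) (h1 : x ≤ 1) {n k : ℕ}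
    (hk : k ≤ n) : (n.choose k : ℝ) * x ^ k * (1 - x) ^ (n - k) ≤ 1 := by
  have h := add_pow x (1 - x) n
  rw [add_sub_cancel, one_pow] at h
  have hx : 0 ≤ 1 - x := sub_nonneg.mpr h1
  have hs := Finset.single_le_sum
    (f := fun m => x ^ m * (1 - x) ^ (n - m) * (n.choose m : ℝ)) (fun i _ => by positivity)
    (Finset.mem_range.mpr (Nat.lt_succ_of_le hk))
  rw [← h] at hs
  exact le_of_eq_of_le (by ring) hs

/-- The entropy bound for binomial coefficients, with weights `1 / (m + 1)` and `m / (m + 1)`. -/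
theorem Nat.choose_le_pow_mul_pow {m n k : ℕ} (hm : 0 < m) (hk : k ≤ n) :
    (n.choose k : ℝ) ≤ (m : ℝ) ^ k * (1 + 1 / (m : ℝ)) ^ n := by
  have hm' : (0 : ℝ) < m := by exact_mod_cast hm
  have h := Nat.choose_mul_pow_mul_pow_le_one (x := 1 / ((m : ℝ) + 1)) (by positivity)
    ((div_le_one (by positivity)).mpr (by linarith)) hk
  have e1 : 1 - 1 / ((m : ℝ) + 1) = m * (1 / ((m : ℝ) + 1)) := by field_simp; ring
  have e2 : 1 + 1 / (m : ℝ) = (m * (1 / ((m : ℝ) + 1)))⁻¹ := by field_simp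
  rw [e1] at h
  rw [e2, inv_pow, ← div_eq_mul_inv, le_div_iff₀ (by positivity)]
  set z := 1 / ((m : ℝ) + 1) with hz
  have e3 : (m * z) ^ n = (m : ℝ) ^ k * (z ^ k * (m * z) ^ (n - k)) := by
    rw [← mul_assoc, ← mul_pow, ← pow_add, Nat.add_sub_cancel' hk]
  rw [e3]
  have hp : (0 : ℝ) ≤ (m : ℝ) ^ k := by positivity
  calc _ = (m : ℝ) ^ k * ((n.choose k : ℝ) * z ^ k * (m * z) ^ (n - k)) := by ring
    _ ≤ (m : ℝ) ^ k * 1 := mul_le_mul_of_nonneg_left h hp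
    _ = _ := mul_one _

theorem one_add_pow_le_exp {x : ℝ} (hx : 0 ≤ x) (n : ℕ) : (1 + x) ^ n ≤ Real.exp (n * x) := by
  rw [Real.exp_nat_mul]
  exact pow_le_pow_left₀ (by linarith) (by linarith [Real.add_one_le_exp x]) n

/-- The exponent is at most `n * (1/20 + 1/99 + 1/6 - 19/70) + 19/10`; the coefficient of `n` is
below `-1/25`, and the constant pays for rounding in `n / 7`. -/
theorem choose_mul_choose_mul_pow_le {n r : ℕ} (hr : 2 ≤ r) :
    ((n.choose (n / 100) : ℝ) * n.choose (n / 7)) *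
        (((n / 100 + n / 7 : ℕ) : ℝ)) ^ (n / 7 * r)
      ≤ Real.exp (2 - n / 25) * (n : ℝ) ^ (n / 7 * r) := by
  set t := n / 100 with ht
  set b := n / 7 with hb
  have ht1 : 100 * (t : ℝ) ≤ n := by exact_mod_cast (by omega : 100 * t ≤ n)
  have hb1 : 7 * (b : ℝ) ≤ n := by exact_mod_cast (by omega : 7 * b ≤ n)
  have hb2 : (n : ℝ) ≤ 7 * b + 7 := by exact_mod_cast (by omega : n ≤ 7 * b + 7)
  -- The weight `1 / (m + 1)` is matched to the density: `m = 99` for `n / 100` and `m = 6` for `n /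
  -- 7`. Here `99 ≤ exp 5`.
  have c1 : (n.choose t : ℝ) ≤ Real.exp (5 * t + n / 99) := by
    refine (Nat.choose_le_pow_mul_pow (m := 99) (by norm_num) (by omega)).trans ?_
    rw [Real.exp_add]
    refine mul_le_mul ?_ ?_ (by positivity) (by positivity)
    · rw [mul_comm, Real.exp_nat_mul]
      refine pow_le_pow_left₀ (by positivity) ?_ _
      have : (5 : ℝ) = ((5 : ℕ) : ℝ) * 1 := by norm_num
      rw [this, Real.exp_nat_mul]
      refine le_trans ?_ (pow_le_pow_left₀ (by norm_num) Real.exp_one_gt_d9.le 5)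
      norm_num
    · refine (one_add_pow_le_exp (by positivity) n).trans (le_of_eq ?_)
      congr 1
      push_cast
      ring
  have c2 : (n.choose b : ℝ) ≤ 6 ^ b * Real.exp (n / 6) := by
    refine (Nat.choose_le_pow_mul_pow (m := 6) (by norm_num) (by omega)).trans ?_
    push_cast
    refine mul_le_mul_of_nonneg_left ?_ (by positivity)
    refine (one_add_pow_le_exp (by positivity) n).trans (le_of_eq ?_)
    congr 1
    ring
  have c3 : (((t + b : ℕ) : ℝ)) ^ (b * r) ≤ (153 / 1000) ^ (2 * b) * (n : ℝ) ^ (b * r) := by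
    -- `1/100 + 1/7 < 0.153`.
    have h1 : ((t + b : ℕ) : ℝ) ≤ 153 / 1000 * n := by
      push_cast
      linarith
    calc (((t + b : ℕ) : ℝ)) ^ (b * r) ≤ (153 / 1000 * n) ^ (b * r) :=
          pow_le_pow_left₀ (by positivity) h1 _
      _ = (153 / 1000) ^ (b * r) * (n : ℝ) ^ (b * r) := mul_pow _ _ _
      _ ≤ _ := by
        refine mul_le_mul_of_nonneg_right ?_ (by positivity)
        refine pow_le_pow_of_le_one (by norm_num) (by norm_num) ?_
        rw [Nat.mul_comm]
        exact Nat.mul_le_mul_left _ hr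
  have c4 : (6 : ℝ) ^ b * (153 / 1000) ^ (2 * b) ≤ Real.exp (-(19 / 10) * b) := by
    rw [pow_mul, ← mul_pow, mul_comm (-(19 / 10) : ℝ), Real.exp_nat_mul]
    refine pow_le_pow_left₀ (by positivity) ?_ _
    -- The tenth power makes the exponent an integer, so a decimal bound on `exp 1` suffices.
    refine le_of_pow_le_pow_left₀ (n := 10) (by norm_num) (by positivity) ?_
    rw [← Real.exp_nat_mul, show ((10 : ℕ) : ℝ) * -(19 / 10) = -(((19 : ℕ) : ℝ) * 1) by norm_num,
      Real.exp_neg, Real.exp_nat_mul]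
    refine le_trans ?_ (inv_anti₀ (by positivity)
      (pow_le_pow_left₀ (by positivity) Real.exp_one_lt_d9.le 19))
    norm_num
  calc _ ≤ (Real.exp (5 * t + n / 99) * (6 ^ b * Real.exp (n / 6))) *
        ((153 / 1000) ^ (2 * b) * (n : ℝ) ^ (b * r)) := by gcongr
    _ = Real.exp (5 * t + n / 99) * Real.exp (n / 6) * (6 ^ b * (153 / 1000) ^ (2 * b)) *
        (n : ℝ) ^ (b * r) := by ring
    _ ≤ Real.exp (5 * t + n / 99) * Real.exp (n / 6) * Real.exp (-(19 / 10) * b) *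
        (n : ℝ) ^ (b * r) := by gcongr
    _ ≤ _ := by
      rw [← Real.exp_add, ← Real.exp_add]
      gcongr
      linarith

/-- Giving up half of the rate `1/25` absorbs the polynomial cost of conditioning. -/
theorem eventually_mul_pow_mul_exp_le (r k : ℕ) :
    ∀ᶠ n : ℕ in atTop, Real.exp (2 - (n : ℝ) / 25) * (2 * ((n : ℝ) * r) ^ k)
      ≤ Real.exp (-(1 / 50 * n)) := by
  have hρ : |Real.exp (-(1 / 50))| < 1 := by
    rw [abs_of_pos (Real.exp_pos _), Real.exp_lt_one_iff]
    norm_num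
  have hlim := (tendsto_pow_const_mul_const_pow_of_abs_lt_one k hρ).const_mul
    (2 * Real.exp 2 * (r : ℝ) ^ k)
  rw [mul_zero] at hlim
  filter_upwards [hlim.eventually_le_const one_pos] with n hn
  have e : Real.exp (2 - (n : ℝ) / 25)
      = Real.exp 2 * Real.exp (-(1 / 50)) ^ n * Real.exp (-(1 / 50 * n)) := by
    rw [← Real.exp_nat_mul, ← Real.exp_add, ← Real.exp_add]
    congr 1
    ring
  rw [e, mul_pow]
  calc _ = (2 * Real.exp 2 * (r : ℝ) ^ k * ((n : ℝ) ^ k * Real.exp (-(1 / 50)) ^ n))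
        * Real.exp (-(1 / 50 * n)) := by ring
    _ ≤ 1 * Real.exp (-(1 / 50 * n)) := by gcongr
    _ = _ := one_mul _

/-! ### The probability statement. -/

theorem proposition4p2 (r : ℕ) (hr : 2 ≤ r) :
    HoldsWithVeryHighProbability
      (fun n : ℕ => uniformOn (Digraph.regularOrientedGraphs n r))
      (fun n : ℕ => {D : Digraph (Fin n) | (D.acyclicNumber : ℝ) ≤ 99 / 100 * (n : ℝ)}) := by
  classical
  refine ⟨1 / 50, by norm_num, ?_⟩
  filter_upwards [eventually_mul_pow_mul_exp_le r (20 * r ^ 2),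
    eventually_gt_atTop (2 * ((4 * r + 2) * r) + 10 * r ^ 2)] with n hexp hn
  have hn' : 2 * ((4 * r + 2) * r) + 10 * r ^ 2 < Fintype.card (Fin n) * r := by
    rw [Fintype.card_fin]
    nlinarith
  set R : Finset (Digraph (Fin n)) :=
    Finset.univ.filter fun D => D ∈ Digraph.regularOrientedGraphs n r with hRdef
  have hR (D : Digraph (Fin n)) : D ∈ R ↔ D.IsOrientedGraph ∧ D.IsRegularDigraph r := by
    exact Finset.mem_filter.trans (and_iff_right (Finset.mem_univ _))
  set A : Finset (Digraph (Fin n)) :=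
    Finset.univ.filter fun D => (D.acyclicNumber : ℝ) ≤ 99 / 100 * (n : ℝ) with hA
  have hRset : Digraph.regularOrientedGraphs n r = (R : Set (Digraph (Fin n))) := by
    simp [hRdef]
  have hAset : {D : Digraph (Fin n) | (D.acyclicNumber : ℝ) ≤ 99 / 100 * (n : ℝ)} = A := by
    simp [hA]
  obtain ⟨hpos, hcount⟩ := Digraph.card_regular_le_acyclicNumber_mul_le (V := Fin n)
    (t := n / 100) (b := n / 7) (by omega) (by rw [Fintype.card_fin]; omega) hn' R hR
  rw [Fintype.card_fin] at hcount
  set E := R.filter fun D => n - n / 100 ≤ D.acyclicNumber with hE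
  -- Outside `A`, integrality turns `α > 99 * n / 100` into `α ≥ n - n / 100` with floor division.
  have hsplit : R.card ≤ (R ∩ A).card + E.card := by
    refine (Finset.card_le_card fun D hD => ?_).trans (Finset.card_union_le _ _)
    by_cases h : D ∈ A
    · exact Finset.mem_union_left _ (Finset.mem_inter.mpr ⟨hD, h⟩)
    · refine Finset.mem_union_right _ (Finset.mem_filter.mpr ⟨hD, ?_⟩)
      have h : 99 / 100 * (n : ℝ) < D.acyclicNumber := by simpa [hA] using h
      have h' : 99 * n < 100 * D.acyclicNumber := by
        have : 99 * (n : ℝ) < 100 * D.acyclicNumber := by linarith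
        exact_mod_cast this
      omega
  have hRpos : (0 : ℝ) < R.card := by exact_mod_cast hpos
  have hnpos : (0 : ℝ) < n := by
    have : 0 < n := by omega
    exact_mod_cast this
  have hEle : (E.card : ℝ) ≤ Real.exp (-(1 / 50 * n)) * R.card := by
    have hcount' : (E.card : ℝ) * (n : ℝ) ^ (n / 7 * r) ≤
        ((n.choose (n / 100) : ℝ) * n.choose (n / 7)) *
          (((n / 100 + n / 7 : ℕ) : ℝ)) ^ (n / 7 * r) *
          (2 * ((n : ℝ) * r) ^ (20 * r ^ 2)) * R.card := by
      exact_mod_cast hcount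
    refine le_of_mul_le_mul_right (hcount'.trans ?_) (pow_pos hnpos (n / 7 * r))
    calc _ ≤ Real.exp (2 - n / 25) * (n : ℝ) ^ (n / 7 * r) *
          (2 * ((n : ℝ) * r) ^ (20 * r ^ 2)) * R.card := by
          refine mul_le_mul_of_nonneg_right (mul_le_mul_of_nonneg_right
            (choose_mul_choose_mul_pow_le hr) ?_) hRpos.le
          positivity
      _ = Real.exp (2 - n / 25) * (2 * ((n : ℝ) * r) ^ (20 * r ^ 2)) * R.card *
          (n : ℝ) ^ (n / 7 * r) := by ring
      _ ≤ _ := mul_le_mul_of_nonneg_right (mul_le_mul_of_nonneg_right hexp hRpos.le)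
          (pow_pos hnpos _).le
  have hprob : (uniformOn (Digraph.regularOrientedGraphs n r)).real
      {D : Digraph (Fin n) | (D.acyclicNumber : ℝ) ≤ 99 / 100 * (n : ℝ)}
      = (R ∩ A).card / R.card := by
    rw [hRset, hAset, Measure.real, uniformOn_apply_finset, ENNReal.toReal_div,
      ENNReal.toReal_natCast, ENNReal.toReal_natCast]
  rw [hprob, le_div_iff₀ hRpos]
  have hsplit' : (R.card : ℝ) ≤ (R ∩ A).card + E.card := by exact_mod_cast hsplit
  linarith
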